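/- Let $(\Omega,\mathscr B,\mu)$ be a probability space, $T:\Omega\to\Omega$ a measure preserving map for which $\mu$ is ergodic, and $U\subset\Omega$ measurable with $\mu(U)>0$. For a measurable set $B$ let $\tau_B(x)=\min\{j\ge1:T^jx\in B\}$ ($=\infty$ if there is no such $j$). If $\mu(B)>0$, let $\tilde F_B(t)=\mu_B\left(\tau_B>\frac{t}{\mu(B)}\right)$ for $t>0$, where $\mu_B(A)=\mu(A\cap B)/\mu(B)$. On $U$ consider the induced map $\hat T=T^{\tau_U}$ (defined almost everywhere) and the induced measure $\hat\mu(A)=\mu(A)/\mu(U)$; for $B\subset U$ with $\mu(B)>0$ let $\hat\tau_B(x)=\min\{j\ge1:\hat T^jx\in B\}$ and $\hat{\tilde F}_B(t)=\hat\mu_B\left(\hat\tau_B>\frac{t}{\hat\mu(B)}\right)$, where $\hat\mu_B(A)=\hat\mu(A\cap B)/\hat\mu(B)$. Say that a sequence $F_j$ of functions on $(0,\infty)$ has the limiting distribution $G$ if $G:(0,\infty)\to\mathbb R$ is non-increasing and $F_j(t)\to G(t)$ for every $t>0$ at which $G$ is continuous. Let $B_j\subset U$ be measurable sets with $\mu(B_j)>0$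 and $\mu(B_j)\to0$ as $j\to\infty$. Then the sequence $\tilde F_{B_j}$ has a limiting distribution if and only if the sequence $\hat{\tilde F}_{B_j}$ has a limiting distribution. Moreover, if $\tilde F$ and $\hat{\tilde F}$ are limiting distributions of these two sequences, then $\tilde F(t)=\hat{\tilde F}(t)$ for every $t>0$ at which at least one of $\tilde F$ and $\hat{\tilde F}$ is continuous. -/

import Mathlib

open MeasureTheory ProbabilityTheory Filter Topology
open scoped ENNReal

/-- The entry time `τ_B(x) = min {j ≥ 1 : T^j x ∈ B}`, with value `⊤` if the forward orbit of `x`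
never enters `B`. It is called the return time when `x ∈ B`. -/
noncomputable def entryTime {Ω : Type*} (T : Ω → Ω) (B : Set Ω) (x : Ω) : ℕ∞ :=
  sInf ((fun j : ℕ => (j : ℕ∞)) '' {j : ℕ | 1 ≤ j ∧ T^[j] x ∈ B})

theorem iterate_entryTime_mem {Ω : Type*} (T : Ω → Ω) (U : Set Ω) (x : Ω) (hx : x ∈ U) :
    T^[(entryTime T U x).toNat] x ∈ U := by
  rcases Set.eq_empty_or_nonempty {j : ℕ | 1 ≤ j ∧ T^[j] x ∈ U} with h | h
  · simpa [entryTime, h] using hx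
  · obtain ⟨j, hj, hje⟩ := csInf_mem (h.image (fun j : ℕ => (j : ℕ∞)))
    have : entryTime T U x = (j : ℕ∞) := hje.symm
    rw [this, ENat.toNat_natCast]
    exact hj.2

/-- The induced map `T^{τ_U} : U → U`. On the points of `U` that never return to `U` (a null set
for every finite invariant measure) it is set to be the identity. -/
noncomputable def inducedMap {Ω : Type*} (T : Ω → Ω) (U : Set Ω) (x : U) : U :=
  ⟨T^[(entryTime T U (x : Ω)).toNat] (x : Ω), iterate_entryTime_mem T U x x.2⟩

/-- The induced measure on `U`: `A ↦ μ(A) / μ(U)` for measurable `A ⊆ U`. -/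
noncomputable def inducedMeasure {Ω : Type*} [MeasurableSpace Ω] (μ : Measure Ω) (U : Set Ω) :
    Measure U :=
  (μ U)⁻¹ • μ.comap ((↑) : U → Ω)

/-- The return times distribution `t ↦ μ_B(τ_B > t / μ(B))` of a set `B` in the system `(Ω, T, μ)`,
where `μ_B = μ[|B]` is the conditional measure `A ↦ μ(A ∩ B) / μ(B)`. -/
noncomputable def returnDistribution {Ω : Type*} [MeasurableSpace Ω] (T : Ω → Ω) (μ : Measure Ω)
    (B : Set Ω) (t : ℝ) : ℝ :=
  (ProbabilityTheory.cond μ B).real {x | ENNReal.ofReal (t / μ.real B) < (entryTime T B x : ℝ≥0∞)}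

/-- `G` is the limiting distribution on `(0, ∞)` of the sequence `F 0, F 1, …` (of tails
`t ↦ P(X > t)`): `G` is non-increasing, and `F j t → G t` at every point of continuity `t > 0`
of `G`. -/
def IsLimitingDistribution (F : ℕ → ℝ → ℝ) (G : ℝ → ℝ) : Prop :=
  AntitoneOn G (Set.Ioi 0) ∧
    ∀ t : ℝ, 0 < t → ContinuousAt G t → Tendsto (fun j => F j t) atTop (𝓝 (G t))

/-!
The return time law of a set is determined by its hitting time law, and hitting times are easy to
compare between a system and an induced system.

For an invariant probability measure `ν`, stationarity gives
`ν(τ_B > n) - ν(τ_B > n + 1) = ν(B ∩ {τ_B > n})`. Hence the return distribution `F j` is the slope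
of the hitting tail `H j t = ν(τ_(B j) > t / ν(B j))`, up to an error `ν(B j)`
(`isAsymptoticSlope_returnDistribution`). As the `F j` are antitone, two sequences whose hitting
tails are asymptotically equal at each `t` have the same limiting distributions
(`IsLimitingDistribution.of_isAsymptoticSlope`), and two limits of one sequence agree where one of
them is continuous (`IsLimitingDistribution.eq_of_continuousAt`). This applies to the induced system
as well, since the induced map preserves the induced measure (`measurePreserving_inducedMap`).

It remains to compare the hitting tails (`tendsto_tail_sub_inducedMap_tail`), where only the mean
ergodic theorem for the indicator of `U` is needed. If `N` is the number of visits to `U` up to time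
`m`, then for a start in `U` the orbit avoids `B ⊆ U` up to time `m` exactly when the induced orbit
does so up to time `N` (`mem_avoidSet_inducedMap_iff`), and `N / m` is close to `μ U` in measure
(`tendsto_measureReal_visitCount`). Starting in `U` instead of `Ω` is harmless, as the event
`{τ_B > m}` is almost invariant when `μ B` is small, hence almost independent of `U`
(`tendsto_measureReal_inter_avoidSet`).
-/

/-! ### Antitone limits and slopes -/

/-- The values of `F j` are, up to an error tending to `0`, slopes of the function `H j`: every
difference quotient of `-H j` over `[s, t]` lies between `F j t` and `F j s`. -/
def IsAsymptoticSlope (F H : ℕ → ℝ → ℝ) : Prop :=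
  ∃ δ : ℕ → ℝ, Tendsto δ atTop (𝓝 0) ∧ ∀ j s t, 0 < s → s < t →
    (t - s) * F j t - δ j ≤ H j s - H j t ∧ H j s - H j t ≤ (t - s) * F j s + δ j

theorem AntitoneOn.countable_not_continuousAt_Ioi {G : ℝ → ℝ} (hG : AntitoneOn G (Set.Ioi 0)) :
    {t : ℝ | 0 < t ∧ ¬ ContinuousAt G t}.Countable := by
  refine hG.countable_not_continuousWithinAt.mono fun t ht => ?_
  exact ⟨ht.1, fun h => ht.2 (h.continuousAt (Ioi_mem_nhds ht.1))⟩

theorem exists_mem_Ioo_continuousAt {G G' : ℝ → ℝ} (hG : AntitoneOn G (Set.Ioi 0))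
    (hG' : AntitoneOn G' (Set.Ioi 0)) {a b : ℝ} (ha : 0 ≤ a) (hab : a < b) :
    ∃ u ∈ Set.Ioo a b, ContinuousAt G u ∧ ContinuousAt G' u := by
  have hd := (hG.countable_not_continuousAt_Ioi.union
    hG'.countable_not_continuousAt_Ioi).dense_compl ℝ
  obtain ⟨u, hu, hu'⟩ := hd.exists_mem_open isOpen_Ioo (Set.nonempty_Ioo.2 hab)
  have h0 : 0 < u := ha.trans_lt hu'.1
  simp only [Set.mem_compl_iff, Set.mem_union, Set.mem_ofPred_eq, h0, true_and, not_or,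
    not_not] at hu
  exact ⟨u, hu', hu⟩

/-- Continuity of one of the two limits suffices: the other one agrees with it at points arbitrarily
close to `t` on both sides, and is squeezed by monotonicity. -/
theorem IsLimitingDistribution.eq_of_continuousAt {F : ℕ → ℝ → ℝ} {G G' : ℝ → ℝ}
    (h : IsLimitingDistribution F G) (h' : IsLimitingDistribution F G') {t : ℝ} (ht : 0 < t)
    (hc : ContinuousAt G t) : G t = G' t := by
  have key : ∀ a b, 0 ≤ a → a < b → ∃ u ∈ Set.Ioo a b, G u = G' u := by
    intro a b ha hab
    obtain ⟨u, hu, hu1, hu2⟩ := exists_mem_Ioo_continuousAt h.1 h'.1 ha hab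
    have h0 := ha.trans_lt hu.1
    exact ⟨u, hu, tendsto_nhds_unique (h.2 u h0 hu1) (h'.2 u h0 hu2)⟩
  refine le_antisymm (le_of_forall_lt fun c hct => ?_) (le_of_forall_gt fun c hct => ?_)
  · obtain ⟨r, hr, hrt⟩ := exists_Ico_subset_of_mem_nhds (hc.eventually (lt_mem_nhds hct))
      ⟨t + 1, by linarith⟩
    obtain ⟨w, hw, hGw⟩ := key t r ht.le hr
    have : c < G w := hrt ⟨hw.1.le, hw.2⟩
    rw [hGw] at this
    exact this.trans_le (h'.1 ht (ht.trans hw.1) hw.1.le)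
  · obtain ⟨l, hl, hlt⟩ := exists_Ioc_subset_of_mem_nhds (hc.eventually (gt_mem_nhds hct)) ⟨0, ht⟩
    obtain ⟨u, hu, hGu⟩ := key (max l 0) t (le_max_right _ _) (max_lt hl ht)
    have hu0 : 0 < u := (le_max_right _ _).trans_lt hu.1
    have : G u < c := hlt ⟨(le_max_left _ _).trans_lt hu.1, hu.2.le⟩
    rw [hGu] at this
    exact (h'.1 hu0 ht hu.2.le).trans_lt this

/-- If `F` and `F'` are asymptotic slopes of two asymptotically equal sequences of functions, then
they have the same limiting distributions. -/
theorem IsLimitingDistribution.of_isAsymptoticSlope {F F' H H' : ℕ → ℝ → ℝ} {G : ℝ → ℝ}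
    (h : IsLimitingDistribution F G) (hF : IsAsymptoticSlope F H) (hF' : IsAsymptoticSlope F' H')
    (hH : ∀ t, 0 < t → Tendsto (fun j => H j t - H' j t) atTop (𝓝 0)) :
    IsLimitingDistribution F' G := by
  obtain ⟨δ, hδ, hF⟩ := hF
  obtain ⟨δ', hδ', hF'⟩ := hF'
  refine ⟨h.1, fun t ht hc => tendsto_order.2 ⟨fun c hct => ?_, fun c hct => ?_⟩⟩
  -- compare `F' j t` with the slope of `H' j` on an interval `[t, u]`, hence with `F j u`
  · obtain ⟨r, hr, hrt⟩ := exists_Ico_subset_of_mem_nhds (hc.eventually (lt_mem_nhds hct))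
      ⟨t + 1, by linarith⟩
    obtain ⟨u, hu, hGu, -⟩ := exists_mem_Ioo_continuousAt h.1 h.1 ht.le hr
    have hu0 : 0 < u := ht.trans hu.1
    have hcu : c < G u := hrt ⟨hu.1.le, hu.2⟩
    have hut : 0 < u - t := sub_pos.2 hu.1
    have hlim : Tendsto (fun j => (u - t) * F j u - δ j - δ' j - (H j t - H' j t)
        + (H j u - H' j u)) atTop (𝓝 ((u - t) * G u - 0 - 0 - 0 + 0)) :=
      (((((h.2 u hu0 hGu).const_mul _).sub hδ).sub hδ').sub (hH t ht)).add (hH u hu0)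
    have hlt : (u - t) * c < (u - t) * G u - 0 - 0 - 0 + 0 := by
      simpa using mul_lt_mul_of_pos_left hcu hut
    filter_upwards [hlim.eventually (lt_mem_nhds hlt)] with j hj
    have h1 := (hF j t u ht hu.1).1
    have h2 := (hF' j t u ht hu.1).2
    exact lt_of_mul_lt_mul_left (by linarith) hut.le
  · obtain ⟨l, hl, hlt⟩ := exists_Ioc_subset_of_mem_nhds (hc.eventually (gt_mem_nhds hct)) ⟨0, ht⟩
    obtain ⟨u, hu, hGu, -⟩ := exists_mem_Ioo_continuousAt h.1 h.1 (le_max_right l 0)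
      (max_lt hl ht)
    have hu0 : 0 < u := (le_max_right _ _).trans_lt hu.1
    have hcu : G u < c := hlt ⟨(le_max_left _ _).trans_lt hu.1, hu.2.le⟩
    have hut : 0 < t - u := sub_pos.2 hu.2
    have hlim : Tendsto (fun j => (t - u) * F j u + δ j + δ' j - (H j u - H' j u)
        + (H j t - H' j t)) atTop (𝓝 ((t - u) * G u + 0 + 0 - 0 + 0)) :=
      (((((h.2 u hu0 hGu).const_mul _).add hδ).add hδ').sub (hH u hu0)).add (hH t ht)
    have hlt : (t - u) * G u + 0 + 0 - 0 + 0 < (t - u) * c := by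
      simpa using mul_lt_mul_of_pos_left hcu hut
    filter_upwards [hlim.eventually (gt_mem_nhds hlt)] with j hj
    have h1 := (hF j u t hu0 hu.2).2
    have h2 := (hF' j u t hu0 hu.2).1
    exact lt_of_mul_lt_mul_left (by linarith) hut.le

/-! ### The mean ergodic theorem in `L²` and in `L¹` -/

section MeanErgodic

variable {Ω : Type*} [MeasurableSpace Ω] {μ : Measure Ω} {T : Ω → Ω}

/-- Birkhoff averages of the Koopman operator on `L²`, represented by pointwise averages. -/
theorem coeFn_birkhoffAverage_compMeasurePreserving (hT : MeasurePreserving T μ μ) {f : Ω → ℝ}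
    (hf : MemLp f 2 μ) (n : ℕ) :
    ((birkhoffAverage ℝ (Lp.compMeasurePreserving (E := ℝ) (p := 2) T hT) _root_.id n hf.toLp :
      Lp ℝ 2 μ) : Ω → ℝ)
      =ᵐ[μ] birkhoffAverage ℝ T f n := by
  have hk : ∀ k : ℕ, (((Lp.compMeasurePreserving (E := ℝ) (p := 2) T hT)^[k] hf.toLp :
      Lp ℝ 2 μ) : Ω → ℝ)
      =ᵐ[μ] f ∘ T^[k] := by
    intro k
    rw [Lp.compMeasurePreserving_iterate, Lp.toLp_compMeasurePreserving]
    exact MemLp.coeFn_toLp _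
  have hs : ((birkhoffSum (Lp.compMeasurePreserving (E := ℝ) (p := 2) T hT) _root_.id n hf.toLp :
      Lp ℝ 2 μ) : Ω → ℝ) =ᵐ[μ] birkhoffSum T f n := by
    induction n with
    | zero =>
      simp only [birkhoffSum_zero']
      exact Lp.coeFn_zero _ _ _
    | succ n ih =>
      rw [birkhoffSum_succ]
      filter_upwards [Lp.coeFn_add (birkhoffSum (Lp.compMeasurePreserving (E := ℝ) (p := 2) T hT)
        _root_.id n hf.toLp) ((Lp.compMeasurePreserving (E := ℝ) (p := 2) T hT)^[n] hf.toLp),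
        ih, hk n] with x h1 h2 h3
      simp only [_root_.id, Pi.add_apply] at h1 ⊢
      rw [h1, h2, h3, birkhoffSum_succ, Function.comp_apply]
  filter_upwards [Lp.coeFn_smul (n : ℝ)⁻¹ (birkhoffSum (Lp.compMeasurePreserving (E := ℝ) (p := 2)
    T hT) _root_.id n hf.toLp), hs] with x h1 h2
  simp only [birkhoffAverage, h1, Pi.smul_apply, h2]

/-- The mean ergodic theorem in `L²` for an ergodic map. -/
theorem Ergodic.tendsto_eLpNorm_birkhoffAverage_sub_integral [IsProbabilityMeasure μ]
    (hT : Ergodic T μ) {f : Ω → ℝ} (hf : MemLp f 2 μ) :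
    Tendsto (fun n => eLpNorm (fun x => birkhoffAverage ℝ T f n x - ∫ y, f y ∂μ) 2 μ) atTop
      (𝓝 0) := by
  set L := (Lp.compMeasurePreservingₗᵢ ℝ (E := ℝ) (p := 2) T
    hT.toMeasurePreserving).toContinuousLinearMap with hL
  have hL1 : ‖L‖ ≤ 1 := LinearIsometry.norm_toContinuousLinearMap_le _
  have hlim := L.tendsto_birkhoffAverage_orthogonalProjection hL1 hf.toLp
  set P := (L.eqLocus (1 : Lp ℝ 2 μ →L[ℝ] Lp ℝ 2 μ)).orthogonalProjectionOnto hf.toLp with hP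
  -- the projection is invariant, hence constant
  have hinv : L P = P := P.2
  obtain ⟨c, hc⟩ := hT.ae_eq_const_of_ae_eq_comp₀ (g := ((P : Lp ℝ 2 μ) : Ω → ℝ))
    (Lp.aestronglyMeasurable _).aemeasurable.nullMeasurable (by
      have h1 := Lp.coeFn_compMeasurePreserving (P : Lp ℝ 2 μ) hT.toMeasurePreserving
      have h2 : Lp.compMeasurePreserving T hT.toMeasurePreserving (P : Lp ℝ 2 μ) = P := hinv
      rw [h2] at h1
      exact h1.symm)
  -- the constant is found by pairing with the invariant function `1`
  have hone : MemLp (fun _ : Ω => (1 : ℝ)) 2 μ := memLp_const 1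
  have h1mem : hone.toLp ∈ L.eqLocus (1 : Lp ℝ 2 μ →L[ℝ] Lp ℝ 2 μ) := by
    change Lp.compMeasurePreserving T hT.toMeasurePreserving hone.toLp = hone.toLp
    rw [Lp.toLp_compMeasurePreserving]
    rfl
  have hinner : ∀ g : Lp ℝ 2 μ, inner ℝ hone.toLp g = ∫ x, g x ∂μ := by
    intro g
    rw [L2.inner_def]
    refine integral_congr_ae ?_
    filter_upwards [hone.coeFn_toLp] with x hx
    rw [hx]
    simp
  have hPc : c = ∫ x, f x ∂μ := by
    have h1 : inner ℝ hone.toLp (P : Lp ℝ 2 μ) = inner ℝ hone.toLp hf.toLp := by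
      have horth : hf.toLp - (P : Lp ℝ 2 μ) ∈ (L.eqLocus (1 : Lp ℝ 2 μ →L[ℝ] Lp ℝ 2 μ))ᗮ :=
        Submodule.sub_starProjection_mem_orthogonal _
      have := (Submodule.mem_orthogonal _ _).1 horth _ h1mem
      rw [inner_sub_right] at this
      linarith
    rw [hinner, hinner, integral_congr_ae hc, integral_congr_ae hf.coeFn_toLp] at h1
    simpa using h1
  rw [tendsto_iff_norm_sub_tendsto_zero] at hlim
  have hE := ENNReal.tendsto_ofReal hlim
  rw [ENNReal.ofReal_zero] at hE
  refine hE.congr fun n => ?_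
  rw [Lp.norm_def, ENNReal.ofReal_toReal (Lp.eLpNorm_ne_top _)]
  refine eLpNorm_congr_ae ?_
  filter_upwards [Lp.coeFn_sub (birkhoffAverage ℝ L _root_.id n hf.toLp) P, hc,
    coeFn_birkhoffAverage_compMeasurePreserving hT.toMeasurePreserving hf n] with x h1 h2 h3
  rw [h1, Pi.sub_apply, h2, Function.const_apply, hPc]
  exact congrArg (· - _) h3

theorem measurable_birkhoffAverage_indicator (hT : Measurable T) (hU : MeasurableSet U) (n : ℕ) :
    Measurable (birkhoffAverage ℝ T (U.indicator fun _ => (1 : ℝ)) n) := by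
  unfold birkhoffAverage birkhoffSum
  exact (Finset.measurable_fun_sum _ fun k _ => (measurable_const.indicator hU).comp
    (hT.iterate k)).const_smul (n : ℝ)⁻¹

theorem Ergodic.tendsto_eLpNorm_one_birkhoffAverage_indicator [IsProbabilityMeasure μ]
    (hT : Ergodic T μ) {U : Set Ω} (hU : MeasurableSet U) :
    Tendsto (fun n => eLpNorm
      (fun x => birkhoffAverage ℝ T (U.indicator fun _ => (1 : ℝ)) n x - μ.real U) 1 μ) atTop
      (𝓝 0) := by
  have hf : MemLp (U.indicator fun _ => (1 : ℝ)) 2 μ := (memLp_const 1).indicator hU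
  have h := hT.tendsto_eLpNorm_birkhoffAverage_sub_integral hf
  rw [integral_indicator_const _ hU, smul_eq_mul, mul_one] at h
  refine tendsto_of_tendsto_of_tendsto_of_le_of_le tendsto_const_nhds h (fun _ => bot_le)
    fun n => eLpNorm_le_eLpNorm_of_exponent_le (by norm_num) ?_
  exact ((measurable_birkhoffAverage_indicator hT.measurable hU n).sub_const _).aestronglyMeasurable

end MeanErgodic

/-! ### Tails of entry times -/

section Avoid

variable {X : Type*} {S : X → X} {B : Set X}

/-- The set `{τ_B > n}` of points whose orbit stays outside `B` at the times `1, …, n`. -/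
def avoidSet (S : X → X) (B : Set X) (n : ℕ) : Set X :=
  {x | ∀ j, 1 ≤ j → j ≤ n → S^[j] x ∉ B}

theorem mem_avoidSet {n : ℕ} {x : X} :
    x ∈ avoidSet S B n ↔ ∀ j, 1 ≤ j → j ≤ n → S^[j] x ∉ B := Iff.rfl

theorem natCast_lt_entryTime_iff {n : ℕ} {x : X} :
    (n : ℕ∞) < entryTime S B x ↔ x ∈ avoidSet S B n := by
  rw [← not_iff_not, not_lt, mem_avoidSet]
  push Not
  constructor
  · intro h
    have hne : ((fun j : ℕ => (j : ℕ∞)) '' {j : ℕ | 1 ≤ j ∧ S^[j] x ∈ B}).Nonempty := by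
      by_contra hne
      rw [Set.not_nonempty_iff_eq_empty] at hne
      rw [entryTime, hne, sInf_empty, top_le_iff] at h
      exact ENat.natCast_ne_top n h
    obtain ⟨j, hj, hje⟩ := csInf_mem hne
    refine ⟨j, hj.1, ?_, hj.2⟩
    have hje' : entryTime S B x = (j : ℕ∞) := hje.symm
    rw [hje'] at h
    exact_mod_cast h
  · rintro ⟨j, h1, hj, hB⟩
    have hle : entryTime S B x ≤ (j : ℕ∞) := sInf_le ⟨j, ⟨h1, hB⟩, rfl⟩
    exact hle.trans (Nat.cast_le.2 hj)

theorem ofReal_lt_entryTime_iff {s : ℝ} {x : X} :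
    ENNReal.ofReal s < (entryTime S B x : ℝ≥0∞) ↔ x ∈ avoidSet S B ⌊s⌋₊ := by
  rw [← natCast_lt_entryTime_iff]
  induction entryTime S B x with
  | top => simp
  | coe m =>
    rw [ENat.toENNReal_coe, Nat.cast_lt]
    rcases Nat.eq_zero_or_pos m with rfl | hm
    · simp
    · rw [Nat.floor_lt' hm.ne', ← ENNReal.ofReal_natCast, ENNReal.ofReal_lt_ofReal_iff]
      exact_mod_cast hm

theorem avoidSet_zero : avoidSet S B 0 = Set.univ :=
  Set.eq_univ_of_forall fun x => mem_avoidSet.2 fun j h1 h0 => absurd h1 (by omega)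

theorem avoidSet_antitone : Antitone (avoidSet S B) :=
  fun _ _ h _ hx j h1 hj => hx j h1 (hj.trans h)

theorem avoidSet_succ (n : ℕ) : avoidSet S B (n + 1) = S ⁻¹' (avoidSet S B n \ B) := by
  ext x
  simp only [Set.mem_preimage, Set.mem_sdiff, mem_avoidSet, ← Function.iterate_succ_apply]
  constructor
  · exact fun h => ⟨fun j h1 hj => h (j + 1) (by omega) (by omega), h 1 le_rfl (by omega)⟩
  · rintro ⟨h, h0⟩ j h1 hj
    rcases h1.eq_or_lt with rfl | h2
    · exact h0
    · obtain ⟨i, rfl⟩ : ∃ i, j = i + 1 := ⟨j - 1, by omega⟩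
      exact h i (by omega) (by omega)

/-- Passing from `{τ_B > n}` to its preimage shifts the window `1, …, n` by one, so a point can only
be lost by entering `B` at time `n + 1`. -/
theorem avoidSet_diff_preimage_subset (n : ℕ) :
    avoidSet S B n \ S ⁻¹' avoidSet S B n ⊆ S^[n + 1] ⁻¹' B := by
  rintro x ⟨hx, hx'⟩
  simp only [Set.mem_preimage, mem_avoidSet, not_forall, not_not, ← Function.iterate_succ_apply]
    at hx'
  obtain ⟨j, h1, hj, hB⟩ := hx'
  have : ¬ j + 1 ≤ n := fun h => hx _ (by omega) h hB
  obtain rfl : j = n := by omega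
  exact hB

theorem preimage_avoidSet_diff_subset (n : ℕ) :
    S ⁻¹' avoidSet S B n \ avoidSet S B n ⊆ S ⁻¹' B := by
  rintro x ⟨hx, hx'⟩
  simp only [mem_avoidSet, not_forall, not_not] at hx'
  obtain ⟨j, h1, hj, hB⟩ := hx'
  obtain ⟨i, rfl⟩ : ∃ i, j = i + 1 := ⟨j - 1, by omega⟩
  rcases Nat.eq_zero_or_pos i with rfl | hi
  · exact hB
  · exact absurd hB (hx i hi (by omega))

variable [MeasurableSpace X] {ν : Measure X}

theorem measurableSet_avoidSet (hS : Measurable S) (hB : MeasurableSet B) (n : ℕ) :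
    MeasurableSet (avoidSet S B n) := by
  induction n with
  | zero => rw [avoidSet_zero]; exact MeasurableSet.univ
  | succ n ih => rw [avoidSet_succ]; exact hS (ih.diff hB)

/-- Stationarity turns the law of the entry time into the tail of the return time. -/
theorem measureReal_avoidSet_sub_succ [IsFiniteMeasure ν] (hS : MeasurePreserving S ν ν)
    (hB : MeasurableSet B) (n : ℕ) :
    ν.real (avoidSet S B n) - ν.real (avoidSet S B (n + 1)) = ν.real (B ∩ avoidSet S B n) := by
  have hV := measurableSet_avoidSet hS.measurable hB n
  rw [avoidSet_succ, hS.measureReal_preimage (hV.diff hB).nullMeasurableSet,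
    ← measureReal_sdiff_add_inter (s := avoidSet S B n) hB, Set.inter_comm]
  ring

theorem measureReal_avoidSet_sub_le [IsFiniteMeasure ν] (hS : MeasurePreserving S ν ν)
    (hB : MeasurableSet B) {a b : ℕ} (hab : a ≤ b) :
    (b - a : ℝ) * ν.real (B ∩ avoidSet S B b) ≤
        ν.real (avoidSet S B a) - ν.real (avoidSet S B b) ∧
      ν.real (avoidSet S B a) - ν.real (avoidSet S B b) ≤
        (b - a : ℝ) * ν.real (B ∩ avoidSet S B a) := by
  have hmono : ∀ {m n : ℕ}, m ≤ n → ν.real (B ∩ avoidSet S B n) ≤ ν.real (B ∩ avoidSet S B m) :=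
    fun h => measureReal_mono (Set.inter_subset_inter_right _ (avoidSet_antitone h))
  induction b, hab using Nat.le_induction with
  | base => simp
  | succ b hab ih =>
    have h := measureReal_avoidSet_sub_succ hS hB b
    have hba : (0 : ℝ) ≤ b - a := sub_nonneg.2 (Nat.cast_le.2 hab)
    have h1 := mul_le_mul_of_nonneg_left (hmono (Nat.le_add_right b 1)) hba
    have h2 := hmono hab
    have h3 := hmono (Nat.le_add_right b 1)
    push_cast
    constructor <;> linarith [ih.1, ih.2]

theorem returnDistribution_eq (hB : MeasurableSet B) (t : ℝ) :
    returnDistribution S ν B t =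
      (ν.real B)⁻¹ * ν.real (B ∩ avoidSet S B ⌊t / ν.real B⌋₊) := by
  simp only [returnDistribution, ofReal_lt_entryTime_iff]
  rw [Measure.real, cond_apply hB, ENNReal.toReal_mul, ENNReal.toReal_inv]
  rfl

theorem returnDistribution_mem_Icc (t : ℝ) : returnDistribution S ν B t ∈ Set.Icc (0 : ℝ) 1 := by
  refine ⟨measureReal_nonneg, ?_⟩
  unfold returnDistribution
  rcases eq_or_ne (ν B) 0 with h0 | h0
  · simp [cond_eq_zero_of_meas_eq_zero h0]
  · rcases eq_or_ne (ν B) ∞ with hi | hi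
    · simp [ProbabilityTheory.cond, hi]
    · have := cond_isProbabilityMeasure_of_finite h0 hi
      exact measureReal_le_one

theorem tendsto_measureReal_zero {ν : Measure X} [IsFiniteMeasure ν] {B : ℕ → Set X}
    (h : Tendsto (fun j => ν (B j)) atTop (𝓝 0)) :
    Tendsto (fun j => ν.real (B j)) atTop (𝓝 0) := by
  exact (ENNReal.tendsto_toReal ENNReal.zero_ne_top).comp h

/-- The return times distribution is the slope of the tail of the entry time. This rests on the
identity `ν(τ_B > n) - ν(τ_B > n + 1) = ν(B ∩ {τ_B > n})` for an invariant measure `ν`. -/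
theorem isAsymptoticSlope_returnDistribution [IsFiniteMeasure ν] (hS : MeasurePreserving S ν ν)
    {B : ℕ → Set X} (hB : ∀ j, MeasurableSet (B j)) (hB0 : ∀ j, 0 < ν (B j))
    (hlim : Tendsto (fun j => ν (B j)) atTop (𝓝 0)) :
    IsAsymptoticSlope (fun j => returnDistribution S ν (B j))
      (fun j t => ν.real (avoidSet S (B j) ⌊t / ν.real (B j)⌋₊)) := by
  -- `t - s` differs from `(⌊t / ν (B j)⌋ - ⌊s / ν (B j)⌋) * ν (B j)` by at most `ν (B j)`
  refine ⟨fun j => ν.real (B j), tendsto_measureReal_zero hlim, fun j s t hs hst => ?_⟩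
  have hβ : 0 < ν.real (B j) := ENNReal.toReal_pos (hB0 j).ne' (measure_ne_top _ _)
  have hFs := returnDistribution_mem_Icc (S := S) (ν := ν) (B := B j) s
  have hFt := returnDistribution_mem_Icc (S := S) (ν := ν) (B := B j) t
  have eF : ∀ u, ν.real (B j ∩ avoidSet S (B j) ⌊u / ν.real (B j)⌋₊) =
      ν.real (B j) * returnDistribution S ν (B j) u := fun u => by
    rw [returnDistribution_eq (hB j), mul_inv_cancel_left₀ hβ.ne']
  have hab : ⌊s / ν.real (B j)⌋₊ ≤ ⌊t / ν.real (B j)⌋₊ :=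
    Nat.floor_le_floor (by gcongr)
  have h := measureReal_avoidSet_sub_le hS (hB j) hab
  rw [eF, eF] at h
  have fs1 := Nat.floor_le (div_nonneg hs.le hβ.le)
  have fs2 := Nat.lt_floor_add_one (s / ν.real (B j))
  have ft1 := Nat.floor_le (div_nonneg (hs.trans hst).le hβ.le)
  have ft2 := Nat.lt_floor_add_one (t / ν.real (B j))
  rw [le_div_iff₀ hβ] at fs1 ft1
  rw [div_lt_iff₀ hβ] at fs2 ft2
  dsimp only
  generalize returnDistribution S ν (B j) s = x at *
  generalize returnDistribution S ν (B j) t = y at *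
  generalize ν.real (B j) = β at *
  generalize (⌊s / β⌋₊ : ℝ) = a at *
  generalize (⌊t / β⌋₊ : ℝ) = b at *
  constructor
  · refine le_trans ?_ h.1
    nlinarith [hFt.1, hFt.2]
  · refine h.2.trans ?_
    nlinarith [hFs.1, hFs.2]

end Avoid

/-! ### Entry times of the induced map -/

section Visits

variable {Ω : Type*} {T : Ω → Ω} {U : Set Ω}

/-- The number of visits of the orbit of `x` to `U` at the times `1, …, n`. -/
noncomputable def visitCount (T : Ω → Ω) (U : Set Ω) (n : ℕ) (x : Ω) : ℕ :=
  birkhoffSum T (U.indicator fun _ => (1 : ℕ)) n (T x)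

theorem visitCount_zero (x : Ω) : visitCount T U 0 x = 0 := birkhoffSum_zero _ _ _

theorem cast_visitCount_div (n : ℕ) (x : Ω) :
    (visitCount T U n x : ℝ) / n =
      birkhoffAverage ℝ T (U.indicator fun _ => (1 : ℝ)) n (T x) := by
  classical
  simp only [visitCount, birkhoffAverage, birkhoffSum, smul_eq_mul, Nat.cast_sum, div_eq_inv_mul]
  congr 1
  refine Finset.sum_congr rfl fun k _ => ?_
  simp only [Set.indicator_apply]
  split_ifs <;> simp

theorem visitCount_succ_of_mem {n : ℕ} {x : Ω} (h : T^[n + 1] x ∈ U) :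
    visitCount T U (n + 1) x = visitCount T U n x + 1 := by
  rw [visitCount, birkhoffSum_succ, ← Function.iterate_succ_apply, Set.indicator_of_mem h]
  rfl

theorem visitCount_succ_of_notMem {n : ℕ} {x : Ω} (h : T^[n + 1] x ∉ U) :
    visitCount T U (n + 1) x = visitCount T U n x := by
  rw [visitCount, birkhoffSum_succ, ← Function.iterate_succ_apply, Set.indicator_of_notMem h]
  rfl

theorem visitCount_add (m n : ℕ) (x : Ω) :
    visitCount T U (m + n) x = visitCount T U m x + visitCount T U n (T^[m] x) := by
  rw [visitCount, birkhoffSum_add, ← Function.iterate_succ_apply, Function.iterate_succ_apply']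
  rfl

theorem visitCount_mono (x : Ω) : Monotone fun n => visitCount T U n x := by
  intro m n h
  obtain ⟨k, rfl⟩ := Nat.exists_eq_add_of_le h
  simp only [visitCount_add]
  exact Nat.le_add_right _ _

theorem visitCount_eq_zero_of_mem_avoidSet {n : ℕ} {x : Ω} (h : x ∈ avoidSet T U n) :
    visitCount T U n x = 0 := by
  induction n with
  | zero => exact visitCount_zero x
  | succ n ih =>
    rw [visitCount_succ_of_notMem (h _ (by omega) le_rfl)]
    exact ih (avoidSet_antitone n.le_succ h)

theorem exists_visitCount_eq (x : Ω) {i m : ℕ} (hi : 1 ≤ i) (him : i ≤ visitCount T U m x) :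
    ∃ n, 1 ≤ n ∧ n ≤ m ∧ T^[n] x ∈ U ∧ visitCount T U n x = i := by
  induction m with
  | zero => rw [visitCount_zero] at him; omega
  | succ m ih =>
    by_cases h : T^[m + 1] x ∈ U
    · rcases him.eq_or_lt with h1 | h1
      · exact ⟨m + 1, by omega, le_rfl, h, h1.symm⟩
      · rw [visitCount_succ_of_mem h] at h1
        obtain ⟨n, hn⟩ := ih (by omega)
        exact ⟨n, hn.1, hn.2.1.trans m.le_succ, hn.2.2⟩
    · rw [visitCount_succ_of_notMem h] at him
      obtain ⟨n, hn⟩ := ih him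
      exact ⟨n, hn.1, hn.2.1.trans m.le_succ, hn.2.2⟩

theorem entryTime_eq_succ_iff {x : Ω} {n : ℕ} :
    entryTime T U x = (n + 1 : ℕ) ↔ x ∈ avoidSet T U n ∧ T^[n + 1] x ∈ U := by
  have h1 := natCast_lt_entryTime_iff (S := T) (B := U) (n := n) (x := x)
  have h2 := natCast_lt_entryTime_iff (S := T) (B := U) (n := n + 1) (x := x)
  have h3 : x ∈ avoidSet T U (n + 1) ↔ x ∈ avoidSet T U n ∧ T^[n + 1] x ∉ U := by
    constructor
    · exact fun h => ⟨avoidSet_antitone n.le_succ h, h _ (by omega) le_rfl⟩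
    · rintro ⟨h, h'⟩ j hj1 hj2
      rcases hj2.eq_or_lt with rfl | hj2
      · exact h'
      · exact h j hj1 (by omega)
  have h4 : entryTime T U x = (n + 1 : ℕ) ↔
      (n : ℕ∞) < entryTime T U x ∧ ¬ (((n + 1 : ℕ) : ℕ∞) < entryTime T U x) := by
    induction entryTime T U x with
    | top => exact ⟨fun h => absurd h.symm (ENat.natCast_ne_top _),
        fun h => absurd (ENat.natCast_lt_top _) h.2⟩
    | coe m => simp only [Nat.cast_inj, Nat.cast_lt]; omega
  rw [h4, h1, h2, h3]
  tauto

theorem inducedMap_apply_of_entryTime {x : U} {n : ℕ} (h : entryTime T U x = (n : ℕ)) :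
    (inducedMap T U x : Ω) = T^[n] x := by
  simp [inducedMap, h]

/-- A visit of the orbit of `x ∈ U` to `U` is the iterate of `x` under the induced map whose index
is the number of visits so far. -/
theorem iterate_inducedMap_visitCount (n : ℕ) (x : U) (h : T^[n] (x : Ω) ∈ U) :
    ((inducedMap T U)^[visitCount T U n x] x : Ω) = T^[n] x := by
  induction n using Nat.strong_induction_on generalizing x with
  | _ n ih =>
    rcases Nat.eq_zero_or_pos n with rfl | hn
    · simp [visitCount_zero]
    · -- the first visit takes place at some time `r + 1 ≤ n`
      have hex : ∃ r, T^[r + 1] (x : Ω) ∈ U := ⟨n - 1, by rwa [Nat.sub_add_cancel hn]⟩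
      classical
      have hr := Nat.find_spec hex
      have hmin : ∀ j, j < Nat.find hex → T^[j + 1] (x : Ω) ∉ U := fun j hj => Nat.find_min hex hj
      have hle : Nat.find hex ≤ n - 1 := Nat.find_le (by rwa [Nat.sub_add_cancel hn])
      generalize Nat.find hex = r at hr hmin hle
      have hav : (x : Ω) ∈ avoidSet T U r := by
        intro j h1 hj
        obtain ⟨i, rfl⟩ : ∃ i, j = i + 1 := ⟨j - 1, by omega⟩
        exact hmin i (by omega)
      have hind := inducedMap_apply_of_entryTime (entryTime_eq_succ_iff.2 ⟨hav, hr⟩)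
      obtain ⟨k, rfl⟩ : ∃ k, n = (r + 1) + k := ⟨n - (r + 1), by omega⟩
      have hk : T^[k] (inducedMap T U x : Ω) = T^[(r + 1) + k] (x : Ω) := by
        rw [hind, ← Function.iterate_add_apply, Nat.add_comm k]
      have := ih k (by omega) (inducedMap T U x) (by rwa [hk])
      rw [visitCount_add, visitCount_succ_of_mem hr, visitCount_eq_zero_of_mem_avoidSet hav,
        zero_add, Nat.add_comm 1, Function.iterate_succ_apply, ← hind, this, hk]

/-- For `x ∈ U` and `B ⊆ U`, the orbit of `x` meets `B` up to time `m` if and only if the orbit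
under the induced map meets `B` up to the number of visits to `U` up to time `m`. -/
theorem mem_avoidSet_inducedMap_iff {B : Set Ω} (hBU : B ⊆ U) (m : ℕ) (x : U) :
    x ∈ avoidSet (inducedMap T U) ((↑) ⁻¹' B : Set U) (visitCount T U m x) ↔
      (x : Ω) ∈ avoidSet T B m := by
  constructor
  · intro h k h1 hk hB
    have hU := hBU hB
    obtain ⟨l, rfl⟩ : ∃ l, k = l + 1 := ⟨k - 1, by omega⟩
    refine h (visitCount T U (l + 1) x) ?_ (visitCount_mono _ hk) ?_
    · rw [visitCount_succ_of_mem hU]; omega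
    · rw [Set.mem_preimage, iterate_inducedMap_visitCount _ _ hU]
      exact hB
  · intro h i h1 hi hB
    obtain ⟨n, hn1, hnm, hnU, hni⟩ := exists_visitCount_eq (x : Ω) h1 hi
    rw [Set.mem_preimage, ← hni, iterate_inducedMap_visitCount _ _ hnU] at hB
    exact h n hn1 hnm hB

end Visits

/-! ### Invariance of the induced measure -/

section Induced

variable {Ω : Type*} [MeasurableSpace Ω] {μ : Measure Ω} {T : Ω → Ω} {U : Set Ω}

theorem measurable_inducedMap (hT : Measurable T) (hU : MeasurableSet U) :
    Measurable (inducedMap T U) := by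
  refine Measurable.subtype_mk ?_
  have hτ : Measurable fun x : Ω => (entryTime T U x).toNat := by
    refine measurable_to_countable' fun n => ?_
    have hfin : ∀ n : ℕ, MeasurableSet {x | entryTime T U x = (n : ℕ)} := by
      intro n
      have h0 : ∀ n : ℕ, MeasurableSet {x | (n : ℕ∞) < entryTime T U x} := fun n => by
        simp only [natCast_lt_entryTime_iff]
        exact measurableSet_avoidSet hT hU n
      cases n with
      | zero =>
        have : {x | entryTime T U x = (0 : ℕ)} = {x | ((0 : ℕ) : ℕ∞) < entryTime T U x}ᶜ := by
          ext x; simp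
        rw [this]
        exact (h0 0).compl
      | succ n =>
        simp only [entryTime_eq_succ_iff]
        exact (measurableSet_avoidSet hT hU n).inter (hT.iterate _ hU)
    cases n with
    | zero =>
      have : (fun x : Ω => (entryTime T U x).toNat) ⁻¹' {0} =
          (⋃ n : ℕ, {x | entryTime T U x = ((n + 1 : ℕ) : ℕ∞)})ᶜ := by
        ext x
        simp only [Set.mem_preimage, Set.mem_singleton_iff, Set.mem_compl_iff, Set.mem_iUnion,
          Set.mem_ofPred_eq]
        induction entryTime T U x with
        | top => simpa using fun n : ℕ => (ENat.natCast_ne_top (n + 1)).symm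
        | coe m =>
          simp only [ENat.toNat_natCast, Nat.cast_inj, not_exists]
          exact ⟨fun h n => by omega, fun h => by
            by_contra h0
            exact h (m - 1) (by omega)⟩
      rw [this]
      exact (MeasurableSet.iUnion fun n => hfin _).compl
    | succ n =>
      convert hfin (n + 1) using 1
      ext x
      simp only [Set.mem_preimage, Set.mem_singleton_iff, Set.mem_ofPred_eq]
      induction entryTime T U x with
      | top => simpa using (ENat.natCast_ne_top (n + 1)).symm
      | coe m => simp only [ENat.toNat_natCast, Nat.cast_inj]
  have hit : Measurable fun p : ℕ × Ω => T^[p.1] p.2 :=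
    measurable_from_prod_countable_right fun n => hT.iterate n
  exact hit.comp ((hτ.comp measurable_subtype_coe).prodMk measurable_subtype_coe)

theorem inducedMeasure_apply (hU : MeasurableSet U) (A : Set U) :
    inducedMeasure μ U A = (μ U)⁻¹ * μ ((↑) '' A) := by
  rw [inducedMeasure, Measure.smul_apply, smul_eq_mul,
    (MeasurableEmbedding.subtype_coe hU).comap_apply]

theorem inducedMeasure_real_preimage (hU : MeasurableSet U) (A : Set Ω) :
    (inducedMeasure μ U).real ((↑) ⁻¹' A) = (μ.real U)⁻¹ * μ.real (U ∩ A) := by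
  rw [Measure.real, inducedMeasure_apply hU, Subtype.image_preimage_coe, ENNReal.toReal_mul,
    ENNReal.toReal_inv]
  rfl

theorem isProbabilityMeasure_inducedMeasure [IsFiniteMeasure μ] (hU : MeasurableSet U)
    (hU0 : 0 < μ U) : IsProbabilityMeasure (inducedMeasure μ U) := by
  refine ⟨?_⟩
  rw [inducedMeasure_apply hU, Set.image_univ, Subtype.range_coe,
    ENNReal.inv_mul_cancel hU0.ne' (measure_ne_top _ _)]

/-- The sets `{x | τ_U x = n + 1, T^(n+1) x ∈ A}` split the preimage of `A` under the induced map.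
Their measures telescope, since the part outside `U` of one has the next one as its preimage. -/
theorem measure_iUnion_entry_le [IsFiniteMeasure μ] (hT : MeasurePreserving T μ μ)
    (hU : MeasurableSet U) {A : Set Ω} (hA : MeasurableSet A) :
    μ (⋃ n : ℕ, (avoidSet T U n ∩ T^[n + 1] ⁻¹' A) ∩ U) ≤ μ A := by
  set E : ℕ → Set Ω := fun n => avoidSet T U n ∩ T^[n + 1] ⁻¹' A with hE
  have hEm : ∀ n, MeasurableSet (E n) := fun n =>
    (measurableSet_avoidSet hT.measurable hU n).inter (hT.measurable.iterate _ hA)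
  have hE0 : μ (E 0) = μ A := by
    rw [hE]
    simp only [avoidSet_zero, Set.univ_inter]
    exact (hT.iterate _).measure_preimage hA.nullMeasurableSet
  have hsucc : ∀ n, μ (E (n + 1)) + μ (E n ∩ U) = μ (E n) := by
    intro n
    have : E (n + 1) = T ⁻¹' (E n \ U) := by
      ext x
      simp only [hE, Set.mem_inter_iff, avoidSet_succ, Set.mem_preimage, Set.mem_sdiff,
        ← Function.iterate_succ_apply]
      tauto
    rw [this, hT.measure_preimage ((hEm n).diff hU).nullMeasurableSet, measure_sdiff_add_inter _ hU]
  have hsum : ∀ n, μ (E n) + ∑ k ∈ Finset.range n, μ (E k ∩ U) = μ A := by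
    intro n
    induction n with
    | zero => simpa using hE0
    | succ n ih => rw [Finset.sum_range_succ, add_comm (∑ k ∈ _, _), ← add_assoc, hsucc, ih]
  refine (measure_iUnion_le _).trans ?_
  refine ENNReal.tsum_le_of_sum_range_le fun n => ?_
  rw [← hsum n]
  exact le_add_self

/-- Half of the invariance of the induced measure. The points that never return to `U` are null, so
the value of the induced map there does not matter. -/
theorem inducedMeasure_preimage_inducedMap_le [IsFiniteMeasure μ] (hT : MeasurePreserving T μ μ)
    (hU : MeasurableSet U) {A : Set U} (hA : MeasurableSet A) :
    inducedMeasure μ U (inducedMap T U ⁻¹' A) ≤ inducedMeasure μ U A := by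
  rw [inducedMeasure_apply hU, inducedMeasure_apply hU]
  refine mul_le_mul' le_rfl ?_
  have hA' : MeasurableSet ((↑) '' A : Set Ω) :=
    (MeasurableEmbedding.subtype_coe hU).measurableSet_image.2 hA
  refine le_trans (measure_mono_ae ?_) (measure_iUnion_entry_le hT hU hA')
  -- by Poincaré recurrence almost every point of `U` returns to `U`
  filter_upwards [hT.conservative.ae_mem_imp_frequently_image_mem hU.nullMeasurableSet] with x hx
  rintro ⟨y, hy, rfl⟩
  obtain ⟨n, hn, hnU⟩ := frequently_atTop.1 (hx y.2) 1
  have hne : ¬ (n : ℕ∞) < entryTime T U (y : Ω) := by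
    rw [natCast_lt_entryTime_iff]
    exact fun h => h n hn le_rfl hnU
  have h0 : ((0 : ℕ) : ℕ∞) < entryTime T U (y : Ω) := by
    rw [natCast_lt_entryTime_iff, avoidSet_zero]
    trivial
  obtain ⟨r, hr⟩ : ∃ r : ℕ, entryTime T U (y : Ω) = (r + 1 : ℕ) := by
    generalize entryTime T U (y : Ω) = τ at hne h0
    induction τ with
    | top => exact absurd (ENat.natCast_lt_top n) hne
    | coe m =>
      rw [Nat.cast_lt] at h0
      exact ⟨m - 1, by rw [Nat.sub_add_cancel h0]⟩
  refine Set.mem_iUnion.2 ⟨r, ⟨(entryTime_eq_succ_iff.1 hr).1, ?_⟩, y.2⟩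
  rw [Set.mem_preimage, ← inducedMap_apply_of_entryTime hr]
  exact ⟨_, hy, rfl⟩

/-- The induced measure is invariant. The inequality `≤` for a set and for its complement gives
equality, as the induced measure is finite. -/
theorem measurePreserving_inducedMap [IsFiniteMeasure μ] (hT : MeasurePreserving T μ μ)
    (hU : MeasurableSet U) (hU0 : 0 < μ U) :
    MeasurePreserving (inducedMap T U) (inducedMeasure μ U) (inducedMeasure μ U) := by
  have := isProbabilityMeasure_inducedMeasure (μ := μ) hU hU0
  have hm := measurable_inducedMap hT.measurable hU
  refine ⟨hm, Measure.ext fun A hA => ?_⟩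
  rw [Measure.map_apply hm hA]
  refine le_antisymm (inducedMeasure_preimage_inducedMap_le hT hU hA) ?_
  have h := inducedMeasure_preimage_inducedMap_le hT hU hA.compl
  rw [Set.preimage_compl, prob_compl_eq_one_sub (hm hA), prob_compl_eq_one_sub hA] at h
  exact (ENNReal.sub_le_sub_iff_left prob_le_one ENNReal.one_ne_top).1 h

end Induced

/-! ### Asymptotic independence of `U` and frequency of visits -/

section VisitFrequency

variable {Ω : Type*} [MeasurableSpace Ω] {μ : Measure Ω} {T : Ω → Ω} {U : Set Ω}

theorem abs_measureReal_inter_sub_inter_le [IsFiniteMeasure μ] {s t W : Set Ω} {r : ℝ}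
    (hs : MeasurableSet s) (ht : MeasurableSet t) (hst : μ.real (s \ t) ≤ r)
    (hts : μ.real (t \ s) ≤ r) : |μ.real (W ∩ s) - μ.real (W ∩ t)| ≤ r := by
  have h1 := measureReal_inter_add_sdiff (μ := μ) (s := W ∩ s) ht
  have h2 := measureReal_inter_add_sdiff (μ := μ) (s := W ∩ t) hs
  have h3 : μ.real ((W ∩ s) \ t) ≤ r :=
    (measureReal_mono (Set.sdiff_subset_sdiff_left Set.inter_subset_right)).trans hst
  have h4 : μ.real ((W ∩ t) \ s) ≤ r :=
    (measureReal_mono (Set.sdiff_subset_sdiff_left Set.inter_subset_right)).trans hts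
  rw [Set.inter_right_comm] at h2
  have := measureReal_nonneg (μ := μ) (s := (W ∩ s) \ t)
  have := measureReal_nonneg (μ := μ) (s := (W ∩ t) \ s)
  rw [abs_le]
  constructor <;> linarith

/-- The event `{τ_B > m}` is invariant up to sets of measure `μ B`, uniformly in `m`. -/
theorem abs_measureReal_inter_avoidSet_sub_preimage_le [IsFiniteMeasure μ]
    (hT : MeasurePreserving T μ μ) {B : Set Ω} (hB : MeasurableSet B) (m k : ℕ)
    (hU : MeasurableSet U) :
    |μ.real (U ∩ avoidSet T B m) - μ.real (T^[k] ⁻¹' U ∩ avoidSet T B m)| ≤ k * μ.real B := by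
  have hV := measurableSet_avoidSet hT.measurable hB m
  induction k with
  | zero => simp
  | succ k ih =>
    have hW : MeasurableSet (T^[k] ⁻¹' U) := hT.measurable.iterate k hU
    have h1 : μ.real (T^[k] ⁻¹' U ∩ avoidSet T B m) =
        μ.real (T^[k + 1] ⁻¹' U ∩ T ⁻¹' avoidSet T B m) := by
      rw [← hT.measureReal_preimage (hW.inter hV).nullMeasurableSet, Set.preimage_inter,
        ← Set.preimage_comp, Function.iterate_succ]
    have h2 : |μ.real (T^[k + 1] ⁻¹' U ∩ T ⁻¹' avoidSet T B m) -
        μ.real (T^[k + 1] ⁻¹' U ∩ avoidSet T B m)| ≤ μ.real B := by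
      refine abs_measureReal_inter_sub_inter_le (hT.measurable hV) hV ?_ ?_
      · exact (measureReal_mono (preimage_avoidSet_diff_subset m)).trans_eq
          (hT.measureReal_preimage hB.nullMeasurableSet)
      · exact (measureReal_mono (avoidSet_diff_preimage_subset m)).trans_eq
          ((hT.iterate _).measureReal_preimage hB.nullMeasurableSet)
    rw [← h1] at h2
    have := abs_sub_le (μ.real (U ∩ avoidSet T B m)) (μ.real (T^[k] ⁻¹' U ∩ avoidSet T B m))
      (μ.real (T^[k + 1] ⁻¹' U ∩ avoidSet T B m))
    push_cast
    linarith

theorem integrable_indicator_iterate [IsFiniteMeasure μ] (hT : MeasurePreserving T μ μ)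
    (hU : MeasurableSet U) (k : ℕ) :
    Integrable (fun x => U.indicator (fun _ => (1 : ℝ)) (T^[k] x)) μ :=
  (hT.iterate k).integrable_comp_of_integrable ((integrable_const (1 : ℝ)).indicator hU)

theorem integrable_birkhoffAverage_indicator [IsFiniteMeasure μ] (hT : MeasurePreserving T μ μ)
    (hU : MeasurableSet U) (n : ℕ) :
    Integrable (birkhoffAverage ℝ T (U.indicator fun _ => (1 : ℝ)) n) μ := by
  unfold birkhoffAverage birkhoffSum
  exact (integrable_finsetSum _ fun k _ => integrable_indicator_iterate hT hU k).smul (n : ℝ)⁻¹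

/-- The event `{τ_B > m}` is asymptotically independent of `U` when `μ B` is small: averaging the
approximate invariance over `K` steps replaces the indicator of `U` by its ergodic averages. -/
theorem abs_measureReal_inter_avoidSet_sub_mul_le [IsProbabilityMeasure μ]
    (hT : MeasurePreserving T μ μ) {B : Set Ω} (hB : MeasurableSet B) (hU : MeasurableSet U)
    (m : ℕ) {K : ℕ} (hK : 0 < K) :
    |μ.real (U ∩ avoidSet T B m) - μ.real U * μ.real (avoidSet T B m)| ≤
      K * μ.real B +
        ∫ x, |birkhoffAverage ℝ T (U.indicator fun _ => (1 : ℝ)) K x - μ.real U| ∂μ := by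
  set V := avoidSet T B m
  have hV : MeasurableSet V := measurableSet_avoidSet hT.measurable hB m
  have hK' : (0 : ℝ) < K := Nat.cast_pos.2 hK
  set A := birkhoffAverage ℝ T (U.indicator fun _ => (1 : ℝ)) K with hA
  have hi := integrable_indicator_iterate hT hU
  have hAi : Integrable A μ := integrable_birkhoffAverage_indicator hT hU K
  have hint : ∫ x in V, A x ∂μ =
      (K : ℝ)⁻¹ * ∑ k ∈ Finset.range K, μ.real (T^[k] ⁻¹' U ∩ V) := by
    simp only [hA, birkhoffAverage, birkhoffSum, smul_eq_mul]
    rw [integral_const_mul, integral_finsetSum _ fun k _ => (hi k).integrableOn]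
    congr 1
    refine Finset.sum_congr rfl fun k _ => ?_
    have hpre : (fun x => U.indicator (fun _ => (1 : ℝ)) (T^[k] x)) =
        (T^[k] ⁻¹' U).indicator fun _ => (1 : ℝ) := rfl
    rw [hpre, integral_indicator_const _ (hT.measurable.iterate k hU), smul_eq_mul, mul_one,
      measureReal_restrict_apply (hT.measurable.iterate k hU)]
  have h1 : |μ.real (U ∩ V) - ∫ x in V, A x ∂μ| ≤ K * μ.real B := by
    have hsplit : μ.real (U ∩ V) - ∫ x in V, A x ∂μ = (K : ℝ)⁻¹ *
        ∑ k ∈ Finset.range K, (μ.real (U ∩ V) - μ.real (T^[k] ⁻¹' U ∩ V)) := by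
      rw [hint, Finset.sum_sub_distrib, Finset.sum_const, Finset.card_range, nsmul_eq_mul]
      field_simp
    rw [hsplit, abs_mul, abs_of_pos (inv_pos.2 hK'), inv_mul_le_iff₀ hK']
    refine (Finset.abs_sum_le_sum_abs _ _).trans ?_
    refine (Finset.sum_le_card_nsmul _ _ (K * μ.real B) fun k hk => ?_).trans_eq (by simp)
    refine (abs_measureReal_inter_avoidSet_sub_preimage_le hT hB m k hU).trans ?_
    gcongr
    exact (Finset.mem_range.1 hk).le
  have h2 : |(∫ x in V, A x ∂μ) - μ.real U * μ.real V| ≤ ∫ x, |A x - μ.real U| ∂μ := by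
    have : (∫ x in V, A x ∂μ) - μ.real U * μ.real V = ∫ x in V, (A x - μ.real U) ∂μ := by
      rw [integral_sub hAi.integrableOn (integrable_const _), setIntegral_const, smul_eq_mul,
        mul_comm (μ.real U)]
    rw [this]
    refine (abs_integral_le_integral_abs).trans ?_
    exact setIntegral_le_integral (hAi.sub (integrable_const _)).abs
      (Eventually.of_forall fun x => abs_nonneg _)
  exact (abs_sub_le _ _ _).trans (add_le_add h1 h2)

theorem tendsto_integral_abs_birkhoffAverage_sub [IsProbabilityMeasure μ] (hT : Ergodic T μ)
    (hU : MeasurableSet U) :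
    Tendsto (fun n => ∫ x, |birkhoffAverage ℝ T (U.indicator fun _ => (1 : ℝ)) n x - μ.real U| ∂μ)
      atTop (𝓝 0) := by
  have h := (ENNReal.tendsto_toReal ENNReal.zero_ne_top).comp
    (hT.tendsto_eLpNorm_one_birkhoffAverage_indicator hU)
  refine h.congr fun n => ?_
  have hm : AEStronglyMeasurable (fun x => birkhoffAverage ℝ T (U.indicator fun _ => (1 : ℝ)) n x
      - μ.real U) μ :=
    ((measurable_birkhoffAverage_indicator hT.measurable hU n).sub_const _).aestronglyMeasurable
  rw [Function.comp_apply, eLpNorm_one_eq_lintegral_enorm, ← integral_norm_eq_lintegral_enorm hm]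
  rfl

/-- The starting points may be restricted to `U` without changing the hitting time asymptotics. The
levels `m j` are arbitrary. -/
theorem tendsto_measureReal_inter_avoidSet [IsProbabilityMeasure μ] (hT : Ergodic T μ)
    (hU : MeasurableSet U) (hU0 : 0 < μ U) {B : ℕ → Set Ω} (hB : ∀ j, MeasurableSet (B j))
    (hlim : Tendsto (fun j => μ (B j)) atTop (𝓝 0)) (m : ℕ → ℕ) :
    Tendsto (fun j => (μ.real U)⁻¹ * μ.real (U ∩ avoidSet T (B j) (m j)) -
      μ.real (avoidSet T (B j) (m j))) atTop (𝓝 0) := by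
  have hu : 0 < μ.real U := ENNReal.toReal_pos hU0.ne' (measure_ne_top _ _)
  have key : Tendsto (fun j => μ.real (U ∩ avoidSet T (B j) (m j)) -
      μ.real U * μ.real (avoidSet T (B j) (m j))) atTop (𝓝 0) := by
    rw [Metric.tendsto_atTop']
    refine fun ε hε => ?_
    obtain ⟨K, hK, hK0⟩ := (((tendsto_integral_abs_birkhoffAverage_sub hT hU).eventually
      (gt_mem_nhds (half_pos hε))).and (eventually_gt_atTop 0)).exists
    have hKB : Tendsto (fun j => K * μ.real (B j)) atTop (𝓝 0) := by
      simpa using (tendsto_measureReal_zero hlim).const_mul (K : ℝ)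
    obtain ⟨N, hN⟩ := eventually_atTop.1 (hKB.eventually (gt_mem_nhds (half_pos hε)))
    refine ⟨N, fun j hj => ?_⟩
    rw [Real.dist_0_eq_abs]
    have := abs_measureReal_inter_avoidSet_sub_mul_le hT.toMeasurePreserving (hB j) hU (m j) hK0
    linarith [hN j hj.le]
  have := key.const_mul (μ.real U)⁻¹
  rw [mul_zero] at this
  refine this.congr fun j => ?_
  rw [mul_sub, inv_mul_cancel_left₀ hu.ne']

/-- The frequency of visits to `U` converges to `μ U` in measure. -/
theorem tendsto_measureReal_visitCount [IsProbabilityMeasure μ] (hT : Ergodic T μ)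
    (hU : MeasurableSet U) {ε : ℝ} (hε : 0 < ε) :
    Tendsto (fun n : ℕ => μ.real {x | ε ≤ |(visitCount T U n x : ℝ) / n - μ.real U|}) atTop
      (𝓝 0) := by
  have h := (tendsto_integral_abs_birkhoffAverage_sub hT hU).const_mul ε⁻¹
  rw [mul_zero] at h
  refine squeeze_zero (fun _ => measureReal_nonneg) (fun n => ?_) h
  have hm := (measurable_birkhoffAverage_indicator hT.measurable hU n).sub_const (μ.real U)
  have hset : MeasurableSet {x | ε ≤
      |birkhoffAverage ℝ T (U.indicator fun _ => (1 : ℝ)) n x - μ.real U|} :=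
    measurableSet_le measurable_const hm.abs
  have hpre : {x | ε ≤ |(visitCount T U n x : ℝ) / n - μ.real U|} = T ⁻¹' {x | ε ≤
      |birkhoffAverage ℝ T (U.indicator fun _ => (1 : ℝ)) n x - μ.real U|} := by
    ext x
    simp only [cast_visitCount_div, Set.mem_preimage, Set.mem_ofPred_eq]
  rw [hpre, hT.toMeasurePreserving.measureReal_preimage hset.nullMeasurableSet,
    le_inv_mul_iff₀ hε]
  refine mul_meas_ge_le_integral_of_nonneg (Eventually.of_forall fun x => abs_nonneg _) ?_ ε
  exact ((integrable_birkhoffAverage_indicator hT.toMeasurePreserving hU n).sub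
    (integrable_const _)).abs

end VisitFrequency

/-! ### Comparison of the two systems -/

section InducedTails

variable {Ω : Type*} [MeasurableSpace Ω] {μ : Measure Ω} {T : Ω → Ω} {U : Set Ω}

theorem inducedMeasure_real_le_add [IsFiniteMeasure μ] (hU : MeasurableSet U) {A C : Set U}
    {D : Set Ω} (h : ∀ x ∈ A, x ∈ C ∨ (x : Ω) ∈ D) (hU0 : 0 < μ U) :
    (inducedMeasure μ U).real A ≤ (inducedMeasure μ U).real C + (μ.real U)⁻¹ * μ.real D := by
  have := isProbabilityMeasure_inducedMeasure (μ := μ) hU hU0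
  have hsub : A ⊆ C ∪ (↑) ⁻¹' D := h
  have hle : (inducedMeasure μ U).real A ≤ (inducedMeasure μ U).real (C ∪ (↑) ⁻¹' D) :=
    measureReal_mono hsub
  refine (hle.trans (measureReal_union_le _ _)).trans ?_
  rw [inducedMeasure_real_preimage hU]
  exact add_le_add le_rfl (mul_le_mul_of_nonneg_left (measureReal_mono Set.inter_subset_right)
    (inv_nonneg.2 measureReal_nonneg))

theorem tendsto_floor_div_measureReal [IsFiniteMeasure μ] {B : ℕ → Set Ω}
    (hB0 : ∀ j, 0 < μ (B j)) (hlim : Tendsto (fun j => μ (B j)) atTop (𝓝 0)) {s : ℝ}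
    (hs : 0 < s) : Tendsto (fun j => ⌊s / μ.real (B j)⌋₊) atTop atTop := by
  refine tendsto_nat_floor_atTop.comp ?_
  have h : Tendsto (fun j => μ.real (B j)) atTop (𝓝[>] 0) :=
    tendsto_nhdsWithin_iff.2 ⟨tendsto_measureReal_zero hlim, Eventually.of_forall fun j =>
      ENNReal.toReal_pos (hB0 j).ne' (measure_ne_top _ _)⟩
  simp only [div_eq_mul_inv]
  exact (tendsto_inv_nhdsGT_zero.comp h).const_mul_atTop hs

/-- The hitting times of `B j` under `T` and under the induced map have asymptotically the same law
after rescaling. On `U` the induced clock runs at speed `μ U` up to a small relative error, and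
such an error is harmless because the tails under `T` are asymptotically Lipschitz in `t`. -/
theorem tendsto_tail_sub_inducedMap_tail [IsProbabilityMeasure μ] (hT : Ergodic T μ)
    (hU : MeasurableSet U) (hU0 : 0 < μ U) {B : ℕ → Set Ω} (hB : ∀ j, MeasurableSet (B j))
    (hBU : ∀ j, B j ⊆ U) (hB0 : ∀ j, 0 < μ (B j))
    (hlim : Tendsto (fun j => μ (B j)) atTop (𝓝 0)) {t : ℝ} (ht : 0 < t) :
    Tendsto (fun j => μ.real (avoidSet T (B j) ⌊t / μ.real (B j)⌋₊) -
      (inducedMeasure μ U).real (avoidSet (inducedMap T U) ((↑) ⁻¹' B j : Set U)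
        ⌊t / (inducedMeasure μ U).real ((↑) ⁻¹' B j)⌋₊)) atTop (𝓝 0) := by
  have hc : 0 < μ.real U := ENNReal.toReal_pos hU0.ne' (measure_ne_top _ _)
  have hβ : ∀ j, 0 < μ.real (B j) := fun j => ENNReal.toReal_pos (hB0 j).ne' (measure_ne_top _ _)
  have hβlim := tendsto_measureReal_zero hlim
  have hscale : ∀ j (u : ℝ), u / (inducedMeasure μ U).real ((↑) ⁻¹' B j) =
      u * μ.real U / μ.real (B j) := by
    intro j u
    rw [inducedMeasure_real_preimage hU, Set.inter_eq_right.2 (hBU j)]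
    have := (hβ j).ne'
    field_simp
  have hlip : ∀ j s u, 0 < s → s < u →
      μ.real (avoidSet T (B j) ⌊s / μ.real (B j)⌋₊) -
        μ.real (avoidSet T (B j) ⌊u / μ.real (B j)⌋₊) ≤ (u - s) + μ.real (B j) := by
    intro j s u hs hsu
    have hab : ⌊s / μ.real (B j)⌋₊ ≤ ⌊u / μ.real (B j)⌋₊ :=
      Nat.floor_le_floor (div_le_div_of_nonneg_right hsu.le (hβ j).le)
    have h := (measureReal_avoidSet_sub_le hT.toMeasurePreserving (hB j) hab).2
    refine h.trans ?_
    have h1 := Nat.lt_floor_add_one (s / μ.real (B j))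
    have h2 := Nat.floor_le (div_nonneg (hs.trans hsu).le (hβ j).le)
    rw [div_lt_iff₀ (hβ j)] at h1
    rw [le_div_iff₀ (hβ j)] at h2
    have h3 : μ.real (B j ∩ avoidSet T (B j) ⌊s / μ.real (B j)⌋₊) ≤ μ.real (B j) :=
      measureReal_mono Set.inter_subset_left
    have h4 : (0 : ℝ) ≤ ⌊u / μ.real (B j)⌋₊ - ⌊s / μ.real (B j)⌋₊ :=
      sub_nonneg.2 (Nat.cast_le.2 hab)
    refine (mul_le_mul_of_nonneg_left h3 h4).trans ?_
    linarith
  -- the measure of the deviations of the visit frequency at time `⌊s / μ (B j)⌋`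
  have hdev : ∀ {s ε : ℝ}, 0 < s → 0 < ε → Tendsto (fun j => (μ.real U)⁻¹ *
      μ.real {x | ε ≤ |(visitCount T U ⌊s / μ.real (B j)⌋₊ x : ℝ) / ⌊s / μ.real (B j)⌋₊ -
        μ.real U|}) atTop (𝓝 0) := fun hs hε => by
    simpa using ((tendsto_measureReal_visitCount hT hU hε).comp
      (tendsto_floor_div_measureReal hB0 hlim hs)).const_mul (μ.real U)⁻¹
  have hK : ∀ {s : ℝ}, Tendsto (fun j => (inducedMeasure μ U).real
      ((↑) ⁻¹' avoidSet T (B j) ⌊s / μ.real (B j)⌋₊) -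
        μ.real (avoidSet T (B j) ⌊s / μ.real (B j)⌋₊)) atTop (𝓝 0) := fun {s} => by
    simp only [inducedMeasure_real_preimage hU]
    exact tendsto_measureReal_inter_avoidSet hT hU hU0 hB hlim _
  -- for `s < t`, if the clock is accurate there are at most `t * μ U / μ (B j)` visits to `U` up to
  -- time `s / μ (B j)`, so avoiding `B j` that long under the induced map forces it under `T`
  have hupper : ∀ {s : ℝ}, 0 < s → s < t → ∀ j,
      (inducedMeasure μ U).real (avoidSet (inducedMap T U) ((↑) ⁻¹' B j : Set U)
        ⌊t * μ.real U / μ.real (B j)⌋₊) ≤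
      (inducedMeasure μ U).real ((↑) ⁻¹' avoidSet T (B j) ⌊s / μ.real (B j)⌋₊) +
      (μ.real U)⁻¹ * μ.real {x | (t - s) / s * μ.real U ≤
        |(visitCount T U ⌊s / μ.real (B j)⌋₊ x : ℝ) / ⌊s / μ.real (B j)⌋₊ - μ.real U|} := by
    intro s hs hst j
    refine inducedMeasure_real_le_add hU (fun x hx => ?_) hU0
    have hm := Nat.floor_le (div_nonneg hs.le (hβ j).le)
    generalize ⌊s / μ.real (B j)⌋₊ = m at hm ⊢
    rcases le_or_gt (visitCount T U m x) ⌊t * μ.real U / μ.real (B j)⌋₊ with h | h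
    · exact Or.inl ((mem_avoidSet_inducedMap_iff (hBU j) m x).1 (avoidSet_antitone h hx))
    · right
      rw [Set.mem_ofPred_eq]
      refine le_trans ?_ (le_abs_self _)
      have hlt := Nat.lt_of_floor_lt h
      have hm0 : (0 : ℝ) < m := by
        rcases Nat.eq_zero_or_pos m with rfl | h0
        · rw [visitCount_zero] at h; omega
        · exact_mod_cast h0
      have h1 : t * μ.real U / s ≤ (visitCount T U m (x : Ω) : ℝ) / m := by
        rw [div_le_div_iff₀ hs hm0]
        rw [div_lt_iff₀ (hβ j)] at hlt
        rw [le_div_iff₀ (hβ j)] at hm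
        have hb := hβ j
        have e1 : t * μ.real U * (m * μ.real (B j)) ≤ t * μ.real U * s :=
          mul_le_mul_of_nonneg_left hm (by positivity)
        have e2 := mul_le_mul_of_nonneg_right hlt.le hs.le
        refine le_of_mul_le_mul_right ?_ hb
        linarith
      have h2 : (t - s) / s * μ.real U = t * μ.real U / s - μ.real U := by
        field_simp
      rw [h2]
      linarith
  -- for `t < s` there are at least that many visits; the bound on `μ (B j)` absorbs the rounding of
  -- `s / μ (B j)`
  have hlower : ∀ {s : ℝ}, t < s → ∀ j, 2 * μ.real (B j) ≤ s - t →
      (inducedMeasure μ U).real ((↑) ⁻¹' avoidSet T (B j) ⌊s / μ.real (B j)⌋₊) ≤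
      (inducedMeasure μ U).real (avoidSet (inducedMap T U) ((↑) ⁻¹' B j : Set U)
        ⌊t * μ.real U / μ.real (B j)⌋₊) +
      (μ.real U)⁻¹ * μ.real {x | (s - t) / (s + t) * μ.real U ≤
        |(visitCount T U ⌊s / μ.real (B j)⌋₊ x : ℝ) / ⌊s / μ.real (B j)⌋₊ - μ.real U|} := by
    intro s hts j hj
    have hs : 0 < s := ht.trans hts
    refine inducedMeasure_real_le_add hU (fun x hx => ?_) hU0
    have hm := Nat.lt_floor_add_one (s / μ.real (B j))
    rw [Set.mem_preimage] at hx
    generalize ⌊s / μ.real (B j)⌋₊ = m at hm hx ⊢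
    rcases le_or_gt ⌊t * μ.real U / μ.real (B j)⌋₊ (visitCount T U m x) with h | h
    · exact Or.inl (avoidSet_antitone h ((mem_avoidSet_inducedMap_iff (hBU j) m x).2 hx))
    · right
      rw [Set.mem_ofPred_eq]
      refine le_trans ?_ (neg_le_abs _)
      have hlt : (visitCount T U m (x : Ω) : ℝ) ≤ t * μ.real U / μ.real (B j) :=
        (Nat.cast_le.2 h.le).trans (Nat.floor_le (div_nonneg (by positivity) (hβ j).le))
      have hb := hβ j
      rw [le_div_iff₀ hb] at hlt
      rw [div_lt_iff₀ hb] at hm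
      have hm' : (s + t) / 2 ≤ m * μ.real (B j) := by linarith
      have hm0 : (0 : ℝ) < m := by
        by_contra h0
        have : (m : ℝ) * μ.real (B j) ≤ 0 :=
          mul_nonpos_of_nonpos_of_nonneg (not_lt.1 h0) hb.le
        linarith
      have h1 : (visitCount T U m (x : Ω) : ℝ) / m ≤ 2 * t * μ.real U / (s + t) := by
        rw [div_le_div_iff₀ hm0 (by linarith)]
        have e1 : t * μ.real U * ((s + t) / 2) ≤ t * μ.real U * (m * μ.real (B j)) :=
          mul_le_mul_of_nonneg_left hm' (by positivity)
        have e2 := mul_le_mul_of_nonneg_right hlt (by linarith : 0 ≤ s + t)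
        refine le_of_mul_le_mul_right ?_ hb
        linarith
      have h2 : (s - t) / (s + t) * μ.real U = μ.real U - 2 * t * μ.real U / (s + t) := by
        have : s + t ≠ 0 := by linarith
        field_simp
        ring
      rw [h2]
      linarith
  simp only [hscale]
  refine tendsto_order.2 ⟨fun a ha => ?_, fun a ha => ?_⟩
  · obtain ⟨s, hs, hst⟩ := exists_between (max_lt ht (by linarith : t + a < t))
    have hs0 : 0 < s := (le_max_left _ _).trans_lt hs
    have hsa : t + a < s := (le_max_right _ _).trans_lt hs
    have hsum := ((hdev hs0 (ε := (t - s) / s * μ.real U)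
      (mul_pos (div_pos (sub_pos.2 hst) hs0) hc)).add (hK (s := s))).add hβlim
    filter_upwards [hsum.eventually (gt_mem_nhds (show (0 : ℝ) + 0 + 0 < s - t - a by linarith))]
      with j hj
    have h1 := hupper hs0 hst j
    have h2 := hlip j s t hs0 hst
    linarith
  · obtain ⟨s, hts, hsa⟩ := exists_between (show t < t + a by linarith)
    have hs0 : 0 < s := ht.trans hts
    have hsum := ((hdev hs0 (ε := (s - t) / (s + t) * μ.real U)
      (mul_pos (div_pos (sub_pos.2 hts) (by linarith)) hc)).sub (hK (s := s))).add hβlim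
    filter_upwards [hsum.eventually (gt_mem_nhds (show (0 : ℝ) - 0 + 0 < t + a - s by linarith)),
      hβlim.eventually (gt_mem_nhds (half_pos (sub_pos.2 hts)))] with j hj hj'
    have h1 := hlower hts j (by linarith)
    have h2 := hlip j t s ht hts
    linarith

theorem tendsto_inducedMeasure_preimage (hU : MeasurableSet U) (hU0 : 0 < μ U) {B : ℕ → Set Ω}
    (hBU : ∀ j, B j ⊆ U) (hlim : Tendsto (fun j => μ (B j)) atTop (𝓝 0)) :
    Tendsto (fun j => inducedMeasure μ U ((↑) ⁻¹' B j)) atTop (𝓝 0) := by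
  simp only [inducedMeasure_apply hU, Subtype.image_preimage_coe, Set.inter_eq_right.2 (hBU _)]
  simpa using ENNReal.Tendsto.const_mul hlim (Or.inr (ENNReal.inv_ne_top.2 hU0.ne'))

theorem inducedMeasure_preimage_pos [IsFiniteMeasure μ] (hU : MeasurableSet U) {A : Set Ω}
    (hAU : A ⊆ U) (hA0 : 0 < μ A) : 0 < inducedMeasure μ U ((↑) ⁻¹' A) := by
  rw [inducedMeasure_apply hU, Subtype.image_preimage_coe, Set.inter_eq_right.2 hAU]
  exact ENNReal.mul_pos (ENNReal.inv_ne_zero.2 (measure_ne_top _ _)) hA0.ne'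

end InducedTails

theorem theorem3 {Ω : Type*} [MeasurableSpace Ω] (μ : Measure Ω) [IsProbabilityMeasure μ]
    (T : Ω → Ω) (hT : Ergodic T μ)
    (U : Set Ω) (hU : MeasurableSet U) (hU0 : 0 < μ U)
    (B : ℕ → Set Ω) (hB : ∀ j, MeasurableSet (B j)) (hBU : ∀ j, B j ⊆ U)
    (hB0 : ∀ j, 0 < μ (B j)) (hlim : Tendsto (fun j => μ (B j)) atTop (𝓝 0)) :
    ((∃ G : ℝ → ℝ, IsLimitingDistribution (fun j => returnDistribution T μ (B j)) G) ↔
      (∃ G' : ℝ → ℝ, IsLimitingDistribution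
        (fun j => returnDistribution (inducedMap T U) (inducedMeasure μ U)
          ((↑) ⁻¹' B j : Set U)) G')) ∧
    (∀ G G' : ℝ → ℝ,
      IsLimitingDistribution (fun j => returnDistribution T μ (B j)) G →
      IsLimitingDistribution
        (fun j => returnDistribution (inducedMap T U) (inducedMeasure μ U)
          ((↑) ⁻¹' B j : Set U)) G' →
      ∀ t : ℝ, 0 < t → (ContinuousAt G t ∨ ContinuousAt G' t) → G t = G' t) := by

  have hprob := isProbabilityMeasure_inducedMeasure (μ := μ) hU hU0
  have hslope := isAsymptoticSlope_returnDistribution hT.toMeasurePreserving hB hB0 hlim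
  have hB' : ∀ j, MeasurableSet ((↑) ⁻¹' B j : Set U) := fun j => measurable_subtype_coe (hB j)
  have hB0' : ∀ j, 0 < inducedMeasure μ U ((↑) ⁻¹' B j) := fun j =>
    inducedMeasure_preimage_pos hU (hBU j) (hB0 j)
  have hlim' := tendsto_inducedMeasure_preimage hU hU0 hBU hlim
  have hslope' := isAsymptoticSlope_returnDistribution
    (measurePreserving_inducedMap hT.toMeasurePreserving hU hU0) hB' hB0' hlim'
  have hH := fun (t : ℝ) (ht : 0 < t) =>
    tendsto_tail_sub_inducedMap_tail hT hU hU0 hB hBU hB0 hlim ht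
  refine ⟨⟨?_, ?_⟩, ?_⟩
  · rintro ⟨G, hG⟩
    exact ⟨G, hG.of_isAsymptoticSlope hslope hslope' hH⟩
  · rintro ⟨G, hG⟩
    refine ⟨G, hG.of_isAsymptoticSlope hslope' hslope fun t ht => ?_⟩
    simpa only [neg_sub, neg_zero] using (hH t ht).neg
  intro G G' hG hG' t ht hcont
  have hG₁ := hG.of_isAsymptoticSlope hslope hslope' hH
  rcases hcont with h | h
  · exact hG₁.eq_of_continuousAt hG' ht h
  · exact (hG'.eq_of_continuousAt hG₁ ht h).symm
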